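/- Let $G$ be a countable discrete group and let $H$ be a roughly normal subgroup of $G$, that is, $H$ is infinite and $H\cap g^{-1}Hg$ is infinite for every $g\in G$. Let $(X,\mu)$ be a probability space whose $\sigma$-algebra contains a countable family of sets separating the points of $X$ (for instance a standard Borel probability space), and let $G$ act on $X$ by measurable, $\mu$-preserving transformations $x\mapsto gx$. Assume that the action is free, i.e. for every $g\neq e$ one has $gx\neq x$ for $\mu$-almost every $x\in X$, and mixing, i.e. $\lim_{g\to\infty}\mu(g^{-1}A\cap B)=\mu(A)\mu(B)$ for all measurable $A,B\subseteq X$. For a subgroup $K\le G$ let $L^\infty(X)\rtimes K$ denote the von Neumann subalgebra of $L^\infty(X)\rtimes G\subseteq B(\ell^2(G;L^2(X,\mu)))$ generated by $L^\infty(X)$, acting by $(f\xi)(k)=f\cdot\xi(k)$, and the canonical unitaries $u_g$, $g\in K$, acting by $(u_g\xi)(k)=\sigma_g(\xi(g^{-1}k))$, where $(\sigma_g\eta)(x)=\eta(g^{-1}x)$. Let $\mathsf{P}$ be a von Neumann algebra with $L^\infty(X)\rtimes H\subseteq \mathsf{P}\subseteq L^\infty(X)\rtimes G$. Then there is a subgroup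 $K$ with $H\le K\le G$ such that $\mathsf{P}=L^\infty(X)\rtimes K$. -/

import Mathlib

open MeasureTheory Filter Topology
open scoped ENNReal

/-! ### Subgroups and actions -/

/-- A subgroup `H` of `G` is roughly normal if it is infinite and `H ∩ g⁻¹ H g` is infinite for
every `g : G`. -/
def IsRoughlyNormal {G : Type*} [Group G] (H : Subgroup G) : Prop :=
  (H : Set G).Infinite ∧
    ∀ g : G, ((H : Set G) ∩ (H.map (MulAut.conj g⁻¹).toMonoidHom : Set G)).Infinite

/-- (Essential) freeness of a measurable action: every nontrivial group element moves almost every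
point. -/
def IsFreeAction (G : Type*) [Group G] {X : Type*} [MeasurableSpace X] [MulAction G X]
    (μ : Measure X) : Prop :=
  ∀ g : G, g ≠ 1 → ∀ᵐ x ∂μ, g • x ≠ x

/-- Mixing: `μ (g⁻¹ A ∩ B) → μ A * μ B` as `g → ∞` in the discrete group `G`, for all measurable
sets `A` and `B`. -/
def IsMixingAction (G : Type*) [Group G] {X : Type*} [MeasurableSpace X] [MulAction G X]
    (μ : Measure X) : Prop :=
  ∀ A B : Set X, MeasurableSet A → MeasurableSet B →
    Tendsto (fun g : G => μ ((fun x => g • x) ⁻¹' A ∩ B)) cofinite (𝓝 (μ A * μ B))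

/-! ### Operators on `ℓ²(ι; E)` -/

section AmplificationAndReindexing

variable {ι E : Type*} [NormedAddCommGroup E]

theorem norm_sq_eq_tsum_l2 (ξ : lp (fun _ : ι => E) 2) : ‖ξ‖ ^ 2 = ∑' i, ‖ξ i‖ ^ 2 := by
  have h := lp.norm_rpow_eq_tsum (p := 2) (by norm_num) ξ
  simpa using h

theorem summable_norm_sq_l2 (ξ : lp (fun _ : ι => E) 2) : Summable fun i => ‖ξ i‖ ^ 2 := by
  have h := (lp.memℓp ξ).summable (by norm_num)
  simpa using h

theorem memℓp_two_of_summable {v : ι → E} (h : Summable fun i => ‖v i‖ ^ 2) :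
    Memℓp v 2 := by
  refine memℓp_gen ?_
  simpa using h

variable [NormedSpace ℂ E]

theorem summable_norm_sq_map (T : E →L[ℂ] E) (ξ : lp (fun _ : ι => E) 2) :
    Summable fun i => ‖T (ξ i)‖ ^ 2 := by
  refine Summable.of_nonneg_of_le (fun i => by positivity) (fun i => ?_)
    ((summable_norm_sq_l2 ξ).mul_left (‖T‖ ^ 2))
  rw [← mul_pow]
  exact pow_le_pow_left₀ (norm_nonneg _) (T.le_opNorm _) 2

/-- The operator on `ℓ²(ι; E)` that applies `T` in every coordinate: `(T ξ) i = T (ξ i)`. -/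
noncomputable def l2Ampl (ι : Type*) {E : Type*} [NormedAddCommGroup E] [NormedSpace ℂ E]
    (T : E →L[ℂ] E) : lp (fun _ : ι => E) 2 →L[ℂ] lp (fun _ : ι => E) 2 :=
  LinearMap.mkContinuous
    { toFun := fun ξ => ⟨fun i => T (ξ i), memℓp_two_of_summable (summable_norm_sq_map T ξ)⟩
      map_add' := fun ξ η => by
        ext i
        exact map_add T (ξ i) (η i)
      map_smul' := fun c ξ => by
        ext i
        simp }
    ‖T‖ (fun ξ => by
      refine le_of_sq_le_sq ?_ (by positivity)
      rw [mul_pow, norm_sq_eq_tsum_l2, norm_sq_eq_tsum_l2, ← tsum_mul_left]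
      refine (summable_norm_sq_map T ξ).tsum_le_tsum (fun i => ?_)
        ((summable_norm_sq_l2 ξ).mul_left (‖T‖ ^ 2))
      rw [← mul_pow]
      exact pow_le_pow_left₀ (norm_nonneg _) (T.le_opNorm _) 2)

@[simp]
theorem l2Ampl_apply (T : E →L[ℂ] E) (ξ : lp (fun _ : ι => E) 2) (i : ι) :
    l2Ampl ι T ξ i = T (ξ i) := rfl

/-- The operator on `ℓ²(ι; E)` that permutes coordinates: `ξ ↦ ξ ∘ e`. -/
noncomputable def l2Reindex {ι : Type*} (E : Type*) [NormedAddCommGroup E] [NormedSpace ℂ E]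
    (e : Equiv.Perm ι) : lp (fun _ : ι => E) 2 →L[ℂ] lp (fun _ : ι => E) 2 :=
  LinearMap.mkContinuous
    { toFun := fun ξ => ⟨fun i => ξ (e i),
        memℓp_two_of_summable (e.summable_iff.2 (summable_norm_sq_l2 ξ))⟩
      map_add' := fun ξ η => by
        rfl
      map_smul' := fun c ξ => by
        ext i
        simp }
    1 (fun ξ => by
      refine le_of_sq_le_sq ?_ (by positivity)
      rw [one_mul, norm_sq_eq_tsum_l2, norm_sq_eq_tsum_l2]
      exact (e.tsum_eq fun i => ‖ξ i‖ ^ 2).le)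

@[simp]
theorem l2Reindex_apply (e : Equiv.Perm ι) (ξ : lp (fun _ : ι => E) 2) (i : ι) :
    l2Reindex E e ξ i = ξ (e i) := rfl

end AmplificationAndReindexing

/-! ### Generated von Neumann algebras and crossed products -/

/-- The von Neumann algebra generated by a set `S` of bounded operators: the bicommutant of
`S ∪ S⋆`. -/
noncomputable def generatedVonNeumannAlgebra {𝓗 : Type*} [NormedAddCommGroup 𝓗]
    [InnerProductSpace ℂ 𝓗] [CompleteSpace 𝓗] (S : Set (𝓗 →L[ℂ] 𝓗)) : VonNeumannAlgebra 𝓗 where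
  toStarSubalgebra :=
    StarSubalgebra.centralizer ℂ (StarSubalgebra.centralizer ℂ S : Set (𝓗 →L[ℂ] 𝓗))
  centralizer_centralizer' := by
    change Set.centralizer (Set.centralizer (StarSubalgebra.centralizer ℂ
      (StarSubalgebra.centralizer ℂ S : Set (𝓗 →L[ℂ] 𝓗)) : Set (𝓗 →L[ℂ] 𝓗))) = _
    rw [StarSubalgebra.coe_centralizer_centralizer, Set.centralizer_centralizer_centralizer]
    exact (StarSubalgebra.coe_centralizer_centralizer ℂ S).symm

section CrossedProduct

variable (G : Type*) [Group G] {X : Type*} [MeasurableSpace X] [MulAction G X]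

/-- The Hilbert space `ℓ²(G) ⊗ L²(X, μ)`, realised as `ℓ²(G; L²(X, μ))`. -/
abbrev CrossedProductSpace (μ : Measure X) : Type _ :=
  lp (fun _ : G => Lp ℂ 2 μ) 2

/-- Multiplication by `f ∈ L^∞(X, μ)`, as a bounded operator on `L²(X, μ)`. -/
noncomputable def mulOperator {μ : Measure X} (f : Lp ℂ ∞ μ) : Lp ℂ 2 μ →L[ℂ] Lp ℂ 2 μ :=
  (ContinuousLinearMap.mul ℂ ℂ).holderL μ ∞ 2 2 f

variable {G} in
/-- The Koopman operator of `g`: `(σ_g ξ)(x) = ξ (g⁻¹ x)` on `L²(X, μ)`. -/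
noncomputable def koopmanOperator [MeasurableConstSMul G X] (μ : Measure X)
    [SMulInvariantMeasure G X μ] (g : G) : Lp ℂ 2 μ →L[ℂ] Lp ℂ 2 μ :=
  (Lp.compMeasurePreservingₗᵢ ℂ (fun x : X => g⁻¹ • x)
    (measurePreserving_smul g⁻¹ μ)).toContinuousLinearMap

/-- The copy `1 ⊗ f` of `f ∈ L^∞(X, μ)` in the crossed product. -/
noncomputable def crossedProductFun {μ : Measure X} (f : Lp ℂ ∞ μ) :
    CrossedProductSpace G μ →L[ℂ] CrossedProductSpace G μ :=
  l2Ampl G (mulOperator f)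

variable {G} in
/-- The canonical unitary `u_g = λ_g ⊗ σ_g` of the crossed product:
`(u_g ξ)(k) = σ_g (ξ (g⁻¹ k))`. -/
noncomputable def crossedProductUnitary [MeasurableConstSMul G X] (μ : Measure X)
    [SMulInvariantMeasure G X μ] (g : G) :
    CrossedProductSpace G μ →L[ℂ] CrossedProductSpace G μ :=
  l2Ampl G (koopmanOperator μ g) * l2Reindex (Lp ℂ 2 μ) (Equiv.mulLeft g⁻¹)

variable {G} in
/-- For a subgroup `K` of `G`, the crossed product `L^∞(X, μ) ⋊ K`, realised inside
`L^∞(X, μ) ⋊ G` as the von Neumann algebra generated by `L^∞(X, μ)` and the canonical unitaries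
`u_g`, `g ∈ K`. The crossed product `L^∞(X, μ) ⋊ G` itself is the case `K = ⊤`. -/
noncomputable def crossedProduct [MeasurableConstSMul G X] (μ : Measure X)
    [SMulInvariantMeasure G X μ] (K : Subgroup G) :
    VonNeumannAlgebra (CrossedProductSpace G μ) :=
  generatedVonNeumannAlgebra
    (Set.range (crossedProductFun G (μ := μ)) ∪ crossedProductUnitary μ '' (K : Set G))

end CrossedProduct

open scoped InnerProductSpace

/-! ### Diagonal operators and permutation of coordinates on `ℓ²(ι; E)` -/

section Diagonal

variable {ι E : Type*} [NormedAddCommGroup E] [NormedSpace ℂ E]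

/-! Let Ω = δ_e ⊗ 1. The vacuum state is tracial on `L^∞(X) ⋊ G`, and right multiplications, which
commute with the algebra, move Ω to every δ_k ⊗ 1_B. Hence an intermediate algebra is determined by
the closure of its orbit of Ω (`mem_of_apply_vacuum_mem_vacuumSpace`). The projection e onto the
closure of PΩ plays the role of the conditional expectation: it commutes with left and right
multiplication by `L^∞(X)` and by u_h, h ∈ H.

Apply e to u_gΩ = δ_g ⊗ 1. The relation u_g f = σ_g(f) u_g survives e, and freeness then confines
e(δ_g ⊗ 1) to the coordinate g (`starProjection_elemVec_apply_of_ne`). Since e is a projection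
commuting with `L^∞(X)`, the coordinate is an indicator 1_D
(`starProjection_elemVec_apply_self_ae`). For h in H ∩ gHg⁻¹, commutation with u_h on the left and
u_{g⁻¹hg} on the right makes D invariant under h. There are infinitely many such h, so mixing gives
μ(D)² = μ(D): e either kills δ_g ⊗ 1 or fixes it (`vacuumSpace_dichotomy`).

Take K = {g : u_g ∈ P}. If x ∈ P, then xΩ vanishes off K, so it lies in the vacuum space of `L^∞(X)
⋊ K`, and x belongs to that algebra. -/

theorem summable_norm_sq_diag (T : ι → E →L[ℂ] E) (hT : ∀ i v, ‖T i v‖ ≤ ‖v‖)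
    (ξ : lp (fun _ : ι => E) 2) : Summable fun i => ‖T i (ξ i)‖ ^ 2 :=
  Summable.of_nonneg_of_le (fun i => by positivity)
    (fun i => pow_le_pow_left₀ (norm_nonneg _) (hT i _) 2) (summable_norm_sq_l2 ξ)

/-- The diagonal operator `(T ξ) i = T i (ξ i)` on `ℓ²(ι; E)` given by contractions `T i`. -/
noncomputable def l2Diag (T : ι → E →L[ℂ] E) (hT : ∀ i v, ‖T i v‖ ≤ ‖v‖) :
    lp (fun _ : ι => E) 2 →L[ℂ] lp (fun _ : ι => E) 2 :=
  LinearMap.mkContinuous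
    { toFun := fun ξ => ⟨fun i => T i (ξ i), memℓp_two_of_summable (summable_norm_sq_diag T hT ξ)⟩
      map_add' := fun ξ η => by
        ext i
        exact map_add (T i) (ξ i) (η i)
      map_smul' := fun c ξ => by
        ext i
        simp }
    1 (fun ξ => by
      refine le_of_sq_le_sq ?_ (by positivity)
      rw [one_mul, norm_sq_eq_tsum_l2, norm_sq_eq_tsum_l2]
      exact (summable_norm_sq_diag T hT ξ).tsum_le_tsum
        (fun i => pow_le_pow_left₀ (norm_nonneg _) (hT i _) 2) (summable_norm_sq_l2 ξ))

@[simp]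
theorem l2Diag_apply (T : ι → E →L[ℂ] E) (hT : ∀ i v, ‖T i v‖ ≤ ‖v‖)
    (ξ : lp (fun _ : ι => E) 2) (i : ι) : l2Diag T hT ξ i = T i (ξ i) := rfl

variable [DecidableEq ι]

theorem l2Ampl_single (T : E →L[ℂ] E) (i : ι) (v : E) :
    l2Ampl ι T (lp.single 2 i v) = lp.single 2 i (T v) := by
  ext j
  by_cases h : j = i
  · subst h; simp
  · rw [lp.single_apply_ne _ _ _ h]
    simp [Pi.single_eq_of_ne h]

theorem l2Diag_single (T : ι → E →L[ℂ] E) (hT : ∀ i v, ‖T i v‖ ≤ ‖v‖) (i : ι) (v : E) :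
    l2Diag T hT (lp.single 2 i v) = lp.single 2 i (T i v) := by
  ext j
  by_cases h : j = i
  · subst h; simp
  · rw [lp.single_apply_ne _ _ _ h]
    simp [Pi.single_eq_of_ne h]

theorem l2Reindex_single (e : Equiv.Perm ι) (i : ι) (v : E) :
    l2Reindex E e (lp.single 2 i v) = lp.single 2 (e.symm i) v := by
  ext j
  by_cases h : j = e.symm i
  · subst h; simp
  · rw [lp.single_apply_ne _ _ _ h, l2Reindex_apply,
      lp.single_apply_ne _ _ _ (fun h' => h (by simp [← h']))]

end Diagonal

section Inner

variable {ι E : Type*} [NormedAddCommGroup E] [InnerProductSpace ℂ E]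

theorem inner_l2Ampl_left {S T : E →L[ℂ] E} (h : ∀ v w, ⟪S v, w⟫_ℂ = ⟪v, T w⟫_ℂ)
    (ξ η : lp (fun _ : ι => E) 2) : ⟪l2Ampl ι S ξ, η⟫_ℂ = ⟪ξ, l2Ampl ι T η⟫_ℂ := by
  rw [lp.inner_eq_tsum, lp.inner_eq_tsum]
  exact tsum_congr fun i => h _ _

theorem inner_l2Diag_left {T : ι → E →L[ℂ] E} (hT : ∀ i v, ‖T i v‖ ≤ ‖v‖)
    (h : ∀ i v w, ⟪T i v, w⟫_ℂ = ⟪v, T i w⟫_ℂ)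
    (ξ η : lp (fun _ : ι => E) 2) : ⟪l2Diag T hT ξ, η⟫_ℂ = ⟪ξ, l2Diag T hT η⟫_ℂ := by
  rw [lp.inner_eq_tsum, lp.inner_eq_tsum]
  exact tsum_congr fun i => h _ _ _

theorem inner_l2Reindex_left (e : Equiv.Perm ι) (ξ η : lp (fun _ : ι => E) 2) :
    ⟪l2Reindex E e ξ, η⟫_ℂ = ⟪ξ, l2Reindex E e.symm η⟫_ℂ := by
  rw [lp.inner_eq_tsum, lp.inner_eq_tsum]
  simpa using (e.tsum_eq fun i => ⟪ξ i, η (e.symm i)⟫_ℂ)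

end Inner

/-! ### Multiplication by indicator functions and Koopman operators on `L²` -/

section Indicator

variable {X : Type*} [MeasurableSpace X] {μ : Measure X}

theorem coeFn_mulOperator (f : Lp ℂ ∞ μ) (v : Lp ℂ 2 μ) :
    mulOperator f v =ᵐ[μ] fun x => f x * v x := by
  have h := (ContinuousLinearMap.mul ℂ ℂ).coeFn_holder (r := 2) f v
  exact h

theorem mulOperator_comm (f f' : Lp ℂ ∞ μ) (v : Lp ℂ 2 μ) :
    mulOperator f (mulOperator f' v) = mulOperator f' (mulOperator f v) := by
  ext1
  filter_upwards [coeFn_mulOperator f (mulOperator f' v), coeFn_mulOperator f' (mulOperator f v),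
    coeFn_mulOperator f v, coeFn_mulOperator f' v] with x h1 h2 h3 h4
  rw [h1, h2, h3, h4]
  ring

variable [IsFiniteMeasure μ]

/-- The indicator function of `B` as an element of `L²`. -/
noncomputable def indL2 (μ : Measure X) [IsFiniteMeasure μ] {B : Set X} (hB : MeasurableSet B) :
    Lp ℂ 2 μ :=
  indicatorConstLp 2 hB (measure_ne_top μ B) 1

/-- The indicator function of `B` as an element of `L^∞`. -/
noncomputable def indLinf (μ : Measure X) [IsFiniteMeasure μ] {B : Set X} (hB : MeasurableSet B) :
    Lp ℂ ∞ μ :=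
  indicatorConstLp ∞ hB (measure_ne_top μ B) 1

theorem coeFn_indL2 {B : Set X} (hB : MeasurableSet B) :
    indL2 μ hB =ᵐ[μ] B.indicator fun _ => (1 : ℂ) := indicatorConstLp_coeFn

theorem coeFn_mulOperator_indLinf {B : Set X} (hB : MeasurableSet B) (v : Lp ℂ 2 μ) :
    mulOperator (indLinf μ hB) v =ᵐ[μ] B.indicator v := by
  have h : indLinf μ hB =ᵐ[μ] B.indicator fun _ => (1 : ℂ) := indicatorConstLp_coeFn
  filter_upwards [coeFn_mulOperator (indLinf μ hB) v, h] with x h1 h2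
  rw [h1, h2]
  by_cases hx : x ∈ B <;> simp [hx]

theorem norm_mulOperator_indLinf_le {B : Set X} (hB : MeasurableSet B) (v : Lp ℂ 2 μ) :
    ‖mulOperator (indLinf μ hB) v‖ ≤ ‖v‖ := by
  refine Lp.norm_le_norm_of_ae_le ?_
  filter_upwards [coeFn_mulOperator_indLinf hB v] with x h
  rw [h]
  exact norm_indicator_le_norm_self _ _

theorem inner_mulOperator_indLinf_left {B : Set X} (hB : MeasurableSet B) (v w : Lp ℂ 2 μ) :
    ⟪mulOperator (indLinf μ hB) v, w⟫_ℂ = ⟪v, mulOperator (indLinf μ hB) w⟫_ℂ := by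
  rw [L2.inner_def, L2.inner_def]
  refine integral_congr_ae ?_
  filter_upwards [coeFn_mulOperator_indLinf hB v, coeFn_mulOperator_indLinf hB w] with x h1 h2
  rw [h1, h2]
  by_cases hx : x ∈ B <;> simp [hx]

theorem mulOperator_indLinf_indL2_univ {B : Set X} (hB : MeasurableSet B) :
    mulOperator (indLinf μ hB) (indL2 μ MeasurableSet.univ) = indL2 μ hB := by
  ext1
  filter_upwards [coeFn_mulOperator_indLinf hB (indL2 μ MeasurableSet.univ),
    coeFn_indL2 (μ := μ) hB, coeFn_indL2 (μ := μ) MeasurableSet.univ] with x h1 h2 h3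
  rw [h1, h2]
  by_cases hx : x ∈ B <;> simp [hx, h3]

theorem inner_indL2_left {B : Set X} (hB : MeasurableSet B) (v : Lp ℂ 2 μ) :
    ⟪indL2 μ hB, v⟫_ℂ = ∫ x in B, v x ∂μ :=
  L2.inner_indicatorConstLp_one hB (measure_ne_top μ B) v

theorem integrable_coeFn_L2 (v : Lp ℂ 2 μ) : Integrable v μ :=
  (Lp.memLp v).integrable one_le_two

/-- Indicator functions are total in `L²`. -/
theorem eq_zero_of_inner_indL2 {v : Lp ℂ 2 μ}
    (h : ∀ (B : Set X) (hB : MeasurableSet B), ⟪indL2 μ hB, v⟫_ℂ = 0) : v = 0 := by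
  rw [Lp.eq_zero_iff_ae_eq_zero]
  exact (integrable_coeFn_L2 v).ae_eq_zero_of_forall_setIntegral_eq_zero
    fun B hB _ => by rw [← inner_indL2_left hB, h B hB]

/-- If `⟨v, 1_B⟩ = ⟨1_B, w⟩` for all `B`, then `w` is the complex conjugate of `v`. -/
theorem norm_eq_of_inner_indL2 {v w : Lp ℂ 2 μ}
    (h : ∀ (B : Set X) (hB : MeasurableSet B), ⟪v, indL2 μ hB⟫_ℂ = ⟪indL2 μ hB, w⟫_ℂ) :
    ‖v‖ = ‖w‖ := by
  have h0 : w - star v = 0 := by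
    refine eq_zero_of_inner_indL2 fun B hB => ?_
    rw [inner_sub_right, ← h B hB, ← inner_conj_symm, inner_indL2_left, inner_indL2_left,
      ← integral_conj, sub_eq_zero]
    refine integral_congr_ae (ae_restrict_of_ae ?_)
    filter_upwards [Lp.coeFn_star v] with x hx
    rw [hx]; rfl
  rw [sub_eq_zero.1 h0, Lp.norm_def, Lp.norm_def]
  congr 1
  refine eLpNorm_congr_norm_ae ?_
  filter_upwards [Lp.coeFn_star v] with x hx
  rw [hx, Pi.star_apply, norm_star]

end Indicator

section Koopman

variable {G : Type*} [Group G] {X : Type*} [MeasurableSpace X] [MulAction G X]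
  [MeasurableConstSMul G X] (μ : Measure X) [SMulInvariantMeasure G X μ]

theorem coeFn_koopmanOperator (g : G) (v : Lp ℂ 2 μ) :
    koopmanOperator μ g v =ᵐ[μ] fun x => v (g⁻¹ • x) :=
  Lp.coeFn_compMeasurePreserving v (measurePreserving_smul g⁻¹ μ)

theorem koopmanOperator_mul_apply (g h : G) (v : Lp ℂ 2 μ) :
    koopmanOperator μ g (koopmanOperator μ h v) = koopmanOperator μ (g * h) v := by
  ext1
  filter_upwards [coeFn_koopmanOperator μ g (koopmanOperator μ h v),
    (measurePreserving_smul g⁻¹ μ).quasiMeasurePreserving.ae (coeFn_koopmanOperator μ h v),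
    coeFn_koopmanOperator μ (g * h) v] with x h1 h2 h3
  rw [h1, h2, h3, mul_inv_rev, mul_smul]

theorem koopmanOperator_one_apply (v : Lp ℂ 2 μ) : koopmanOperator μ (1 : G) v = v := by
  ext1
  filter_upwards [coeFn_koopmanOperator μ (1 : G) v] with x h1
  simp [h1]

theorem norm_koopmanOperator_apply (g : G) (v : Lp ℂ 2 μ) : ‖koopmanOperator μ g v‖ = ‖v‖ :=
  Lp.norm_compMeasurePreserving v (measurePreserving_smul g⁻¹ μ)

theorem inner_koopmanOperator_left (g : G) (v w : Lp ℂ 2 μ) :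
    ⟪koopmanOperator μ g v, w⟫_ℂ = ⟪v, koopmanOperator μ g⁻¹ w⟫_ℂ := by
  -- Write w as the image under g of its g⁻¹-translate; the isometry then cancels from both
  -- arguments.
  conv_lhs => rw [← koopmanOperator_one_apply (G := G) μ w, ← mul_inv_cancel g,
    ← koopmanOperator_mul_apply]
  exact (Lp.compMeasurePreservingₗᵢ ℂ (fun x : X => g⁻¹ • x)
    (measurePreserving_smul g⁻¹ μ)).inner_map_map v _

variable [IsFiniteMeasure μ]

theorem measurableSet_translate (g : G) {B : Set X} (hB : MeasurableSet B) :
    MeasurableSet ((fun x : X => g⁻¹ • x) ⁻¹' B) := measurable_const_smul g⁻¹ hB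

theorem koopmanOperator_indL2 (g : G) {B : Set X} (hB : MeasurableSet B) :
    koopmanOperator μ g (indL2 μ hB) = indL2 μ (measurableSet_translate g hB) :=
  Lp.indicatorConstLp_compMeasurePreserving hB (measure_ne_top μ B) 1
    (measurePreserving_smul g⁻¹ μ)

theorem koopmanOperator_indL2_univ (g : G) :
    koopmanOperator μ g (indL2 μ MeasurableSet.univ) = indL2 μ MeasurableSet.univ :=
  koopmanOperator_indL2 μ g MeasurableSet.univ

/-- The covariance relation σ_g 1_{kB} = 1_{gkB} σ_g. The product is a separate variable `l`, so
that the case k = g⁻¹l needs no rewriting inside a measurability proof. -/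
theorem koopmanOperator_mulOperator_indLinf (g : G) {k l : G} (hl : l = g * k) {B : Set X}
    (hB : MeasurableSet B) (v : Lp ℂ 2 μ) :
    koopmanOperator μ g (mulOperator (indLinf μ (measurableSet_translate k hB)) v) =
      mulOperator (indLinf μ (measurableSet_translate l hB)) (koopmanOperator μ g v) := by
  subst hl
  ext1
  filter_upwards [coeFn_koopmanOperator μ g
      (mulOperator (indLinf μ (measurableSet_translate k hB)) v),
    (measurePreserving_smul g⁻¹ μ).quasiMeasurePreserving.ae
      (coeFn_mulOperator_indLinf (measurableSet_translate k hB) v),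
    coeFn_mulOperator_indLinf (measurableSet_translate (g * k) hB) (koopmanOperator μ g v),
    coeFn_koopmanOperator μ g v] with x h1 h2 h3 h4
  rw [h1, h2, h3]
  by_cases hx : k⁻¹ • g⁻¹ • x ∈ B <;> simp [Set.indicator, mul_smul, hx, h4]

end Koopman

/-! ### Generated von Neumann algebras -/

section Generated

variable {𝓗 : Type*} [NormedAddCommGroup 𝓗] [InnerProductSpace ℂ 𝓗] [CompleteSpace 𝓗]

theorem subset_generatedVonNeumannAlgebra (S : Set (𝓗 →L[ℂ] 𝓗)) {s : 𝓗 →L[ℂ] 𝓗} (hs : s ∈ S) :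
    s ∈ generatedVonNeumannAlgebra S := by
  change s ∈ StarSubalgebra.centralizer ℂ (StarSubalgebra.centralizer ℂ S : Set (𝓗 →L[ℂ] 𝓗))
  rw [StarSubalgebra.mem_centralizer_iff]
  intro y hy
  have hy' := StarSubalgebra.mem_centralizer_iff ℂ |>.1 hy s hs
  have hy'' := StarSubalgebra.mem_centralizer_iff ℂ |>.1 (star_mem hy) s hs
  exact ⟨hy'.1.symm, hy''.1.symm⟩

theorem generatedVonNeumannAlgebra_le {S : Set (𝓗 →L[ℂ] 𝓗)} {N : VonNeumannAlgebra 𝓗}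
    (h : ∀ s ∈ S, s ∈ N) : generatedVonNeumannAlgebra S ≤ N := by
  intro x hx
  rw [← N.commutant_commutant, VonNeumannAlgebra.mem_commutant_iff]
  intro y hy
  rw [VonNeumannAlgebra.mem_commutant_iff] at hy
  refine ((StarSubalgebra.mem_centralizer_iff ℂ).1 hx y ?_).1
  exact (StarSubalgebra.mem_centralizer_iff ℂ).2
    fun s hs => ⟨hy s (h s hs), hy _ (star_mem (h s hs))⟩

/-- The condition on `star r` accounts for the adjoints of the generators, as `S` need not be
self-adjoint. -/
theorem commute_of_mem_generatedVonNeumannAlgebra {S : Set (𝓗 →L[ℂ] 𝓗)} {r x : 𝓗 →L[ℂ] 𝓗}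
    (hr : ∀ s ∈ S, s * r = r * s) (hr' : ∀ s ∈ S, s * star r = star r * s)
    (hx : x ∈ generatedVonNeumannAlgebra S) : r * x = x * r := by
  refine ((StarSubalgebra.mem_centralizer_iff ℂ).1 hx r ?_).1
  refine (StarSubalgebra.mem_centralizer_iff ℂ).2 fun s hs => ⟨hr s hs, ?_⟩
  simpa using (congrArg star (hr' s hs)).symm

/-- If a closed subspace is invariant under `T` and `T⋆`, its orthogonal projection commutes
with `T`. -/
theorem starProjection_apply_comm (V : Submodule ℂ 𝓗) [V.HasOrthogonalProjection]
    {T : 𝓗 →L[ℂ] 𝓗} (hT : ∀ v ∈ V, T v ∈ V) (hT' : ∀ v ∈ V, star T v ∈ V) (ξ : 𝓗) :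
    V.starProjection (T ξ) = T (V.starProjection ξ) := by
  refine (Submodule.eq_starProjection_of_mem_of_inner_eq_zero
    (hT _ (V.starProjection_apply_mem ξ)) fun w hw => ?_)
  rw [← map_sub, ← ContinuousLinearMap.adjoint_inner_right]
  exact V.starProjection_inner_eq_zero ξ _ (hT' w hw)

end Generated

/-! ### Left and right operators on the crossed product space -/

section Operators

set_option linter.unusedSectionVars false

variable {G : Type*} [Group G] {X : Type*} [MeasurableSpace X] [MulAction G X]
  [MeasurableConstSMul G X] (μ : Measure X) [SMulInvariantMeasure G X μ]

theorem crossedProductUnitary_apply (g k : G) (ξ : CrossedProductSpace G μ) :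
    crossedProductUnitary μ g ξ k = koopmanOperator μ g (ξ (g⁻¹ * k)) := rfl

theorem crossedProductFun_apply (f : Lp ℂ ∞ μ) (k : G) (ξ : CrossedProductSpace G μ) :
    crossedProductFun G f ξ k = mulOperator f (ξ k) := rfl

theorem crossedProductFun_mem (K : Subgroup G) (f : Lp ℂ ∞ μ) :
    crossedProductFun G f ∈ crossedProduct μ K :=
  subset_generatedVonNeumannAlgebra _ (Or.inl ⟨f, rfl⟩)

theorem crossedProductUnitary_mem {K : Subgroup G} {g : G} (hg : g ∈ K) :
    crossedProductUnitary μ g ∈ crossedProduct μ K :=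
  subset_generatedVonNeumannAlgebra _ (Or.inr ⟨g, hg, rfl⟩)

theorem crossedProduct_le {K : Subgroup G} {N : VonNeumannAlgebra (CrossedProductSpace G μ)}
    (hf : ∀ f : Lp ℂ ∞ μ, crossedProductFun G f ∈ N)
    (hu : ∀ g ∈ K, crossedProductUnitary μ g ∈ N) : crossedProduct μ K ≤ N := by
  refine generatedVonNeumannAlgebra_le ?_
  rintro _ (⟨f, rfl⟩ | ⟨g, hg, rfl⟩)
  exacts [hf f, hu g hg]

theorem crossedProductUnitary_one : crossedProductUnitary μ (1 : G) = 1 := by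
  ext1 ξ
  refine lp.ext (funext fun k => ?_)
  rw [crossedProductUnitary_apply, koopmanOperator_one_apply]
  simp

theorem crossedProductUnitary_mul (g h : G) :
    crossedProductUnitary μ (g * h) = crossedProductUnitary μ g * crossedProductUnitary μ h := by
  ext1 ξ
  refine lp.ext (funext fun k => ?_)
  rw [mul_apply_eq_comp, crossedProductUnitary_apply, crossedProductUnitary_apply,
    crossedProductUnitary_apply, koopmanOperator_mul_apply, mul_inv_rev, mul_assoc]

theorem star_crossedProductUnitary (g : G) :
    star (crossedProductUnitary μ g) = crossedProductUnitary μ g⁻¹ := by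
  refine ((ContinuousLinearMap.eq_adjoint_iff _ _).2 fun ξ η => ?_).symm
  -- The two factors commute; the reversed order is the one produced by taking the adjoint of the
  -- product.
  have h1 : crossedProductUnitary μ g⁻¹ ξ =
      l2Reindex _ (Equiv.mulLeft g) (l2Ampl G (koopmanOperator μ g⁻¹) ξ) := by
    refine lp.ext (funext fun k => ?_)
    rw [crossedProductUnitary_apply, inv_inv]
    rfl
  rw [h1, inner_l2Reindex_left, inner_l2Ampl_left (T := koopmanOperator μ g)
    fun v w => by rw [inner_koopmanOperator_left, inv_inv]]
  rfl

/-- Right translation by `g`: `(ρ_g ξ)(k) = ξ (k g)`. -/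
noncomputable def rightTranslation (g : G) : CrossedProductSpace G μ →L[ℂ] CrossedProductSpace G μ :=
  l2Reindex (Lp ℂ 2 μ) (Equiv.mulRight g)

theorem rightTranslation_apply (g k : G) (ξ : CrossedProductSpace G μ) :
    rightTranslation μ g ξ k = ξ (k * g) := rfl

theorem star_rightTranslation (g : G) :
    star (rightTranslation μ g) = rightTranslation μ g⁻¹ := by
  refine ((ContinuousLinearMap.eq_adjoint_iff _ _).2 fun ξ η => ?_).symm
  exact inner_l2Reindex_left (Equiv.mulRight g⁻¹) ξ η |>.trans (by
    congr 1
    refine lp.ext (funext fun k => ?_)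
    simp [rightTranslation_apply])

variable [IsFiniteMeasure μ]

variable (G) in
/-- Left multiplication by the indicator function of `B`. -/
noncomputable def leftInd {B : Set X} (hB : MeasurableSet B) :
    CrossedProductSpace G μ →L[ℂ] CrossedProductSpace G μ :=
  crossedProductFun G (indLinf μ hB)

theorem leftInd_apply {B : Set X} (hB : MeasurableSet B) (k : G) (ξ : CrossedProductSpace G μ) :
    leftInd G μ hB ξ k = mulOperator (indLinf μ hB) (ξ k) := rfl

theorem star_leftInd {B : Set X} (hB : MeasurableSet B) :
    star (leftInd G μ hB) = leftInd G μ hB :=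
  ((ContinuousLinearMap.eq_adjoint_iff _ _).2
    (inner_l2Ampl_left (inner_mulOperator_indLinf_left hB))).symm

variable (G) in
/-- Right multiplication by the indicator function of `B`: `(R_B ξ)(k) = 1_{kB} ξ(k)`. -/
noncomputable def rightInd {B : Set X} (hB : MeasurableSet B) :
    CrossedProductSpace G μ →L[ℂ] CrossedProductSpace G μ :=
  l2Diag (fun k : G => mulOperator (indLinf μ (measurableSet_translate k hB)))
    fun k => norm_mulOperator_indLinf_le (measurableSet_translate k hB)

theorem rightInd_apply {B : Set X} (hB : MeasurableSet B) (k : G) (ξ : CrossedProductSpace G μ) :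
    rightInd G μ hB ξ k = mulOperator (indLinf μ (measurableSet_translate k hB)) (ξ k) := rfl

theorem star_rightInd {B : Set X} (hB : MeasurableSet B) :
    star (rightInd G μ hB) = rightInd G μ hB :=
  ((ContinuousLinearMap.eq_adjoint_iff _ _).2
    (inner_l2Diag_left _ fun k => inner_mulOperator_indLinf_left
      (measurableSet_translate k hB))).symm

theorem rightTranslation_commute {x : CrossedProductSpace G μ →L[ℂ] CrossedProductSpace G μ}
    (hx : x ∈ crossedProduct μ (⊤ : Subgroup G)) (g : G) :
    rightTranslation μ g * x = x * rightTranslation μ g := by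
  have key : ∀ g : G, ∀ s ∈ Set.range (crossedProductFun G (μ := μ)) ∪
      crossedProductUnitary μ '' ((⊤ : Subgroup G) : Set G),
      s * rightTranslation μ g = rightTranslation μ g * s := by
    rintro g _ (⟨f, rfl⟩ | ⟨h, -, rfl⟩)
    · ext1 ξ
      refine lp.ext (funext fun k => ?_)
      simp only [mul_apply_eq_comp, rightTranslation_apply,
        crossedProductFun_apply]
    · ext1 ξ
      refine lp.ext (funext fun k => ?_)
      simp only [mul_apply_eq_comp, rightTranslation_apply,
        crossedProductUnitary_apply, mul_assoc]
  exact commute_of_mem_generatedVonNeumannAlgebra (key g)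
    (by rw [star_rightTranslation]; exact key g⁻¹) hx

/-- It suffices to check generators: functions commute among themselves, and for u_h the twist kB in
the right action is exactly absorbed by covariance. -/
theorem rightInd_commute {x : CrossedProductSpace G μ →L[ℂ] CrossedProductSpace G μ}
    (hx : x ∈ crossedProduct μ (⊤ : Subgroup G)) {B : Set X} (hB : MeasurableSet B) :
    rightInd G μ hB * x = x * rightInd G μ hB := by
  have key : ∀ s ∈ Set.range (crossedProductFun G (μ := μ)) ∪
      crossedProductUnitary μ '' ((⊤ : Subgroup G) : Set G),
      s * rightInd G μ hB = rightInd G μ hB * s := by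
    rintro _ (⟨f, rfl⟩ | ⟨h, -, rfl⟩)
    · ext1 ξ
      refine lp.ext (funext fun k => ?_)
      simp only [mul_apply_eq_comp, rightInd_apply, crossedProductFun_apply,
        mulOperator_comm f]
    · ext1 ξ
      refine lp.ext (funext fun k => ?_)
      simp only [mul_apply_eq_comp, rightInd_apply, crossedProductUnitary_apply]
      exact koopmanOperator_mulOperator_indLinf μ h (mul_inv_cancel_left h k).symm hB _
  exact commute_of_mem_generatedVonNeumannAlgebra key (by rwa [star_rightInd]) hx

/-! ### The vectors `δ_g ⊗ 1_B` -/

variable [DecidableEq G]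

/-- The vector `δ_g ⊗ 1_B`. -/
noncomputable def elemVec (g : G) {B : Set X} (hB : MeasurableSet B) : CrossedProductSpace G μ :=
  lp.single 2 g (indL2 μ hB)

variable (G) in
/-- The vacuum vector `δ_e ⊗ 1`. -/
noncomputable def vacuum : CrossedProductSpace G μ := elemVec μ 1 MeasurableSet.univ

theorem inner_elemVec_left (g : G) {B : Set X} (hB : MeasurableSet B)
    (ξ : CrossedProductSpace G μ) : ⟪elemVec μ g hB, ξ⟫_ℂ = ⟪indL2 μ hB, ξ g⟫_ℂ :=
  lp.inner_single_left g _ ξ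

theorem inner_elemVec_right (g : G) {B : Set X} (hB : MeasurableSet B)
    (ξ : CrossedProductSpace G μ) : ⟪ξ, elemVec μ g hB⟫_ℂ = ⟪ξ g, indL2 μ hB⟫_ℂ :=
  lp.inner_single_right g _ ξ

theorem eq_zero_of_inner_elemVec {ξ : CrossedProductSpace G μ}
    (h : ∀ (g : G) (B : Set X) (hB : MeasurableSet B), ⟪elemVec μ g hB, ξ⟫_ℂ = 0) : ξ = 0 := by
  refine lp.ext (funext fun g => ?_)
  exact eq_zero_of_inner_indL2 fun B hB => by rw [← inner_elemVec_left, h]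

theorem leftInd_elemVec_univ (g : G) {B : Set X} (hB : MeasurableSet B) :
    leftInd G μ hB (elemVec μ g MeasurableSet.univ) = elemVec μ g hB := by
  rw [leftInd, crossedProductFun, elemVec, l2Ampl_single, mulOperator_indLinf_indL2_univ]
  rfl

theorem rightInd_elemVec_univ (g : G) {B : Set X} (hB : MeasurableSet B) :
    rightInd G μ hB (elemVec μ g MeasurableSet.univ) =
      elemVec μ g (measurableSet_translate g hB) := by
  rw [rightInd, elemVec, l2Diag_single, mulOperator_indLinf_indL2_univ]
  rfl

theorem rightInd_vacuum {B : Set X} (hB : MeasurableSet B) :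
    rightInd G μ hB (vacuum G μ) = elemVec μ 1 hB := by
  rw [vacuum, rightInd_elemVec_univ]
  congr
  simp

theorem crossedProductUnitary_single (g k : G) (v : Lp ℂ 2 μ) :
    crossedProductUnitary μ g (lp.single 2 k v) =
      lp.single 2 (g * k) (koopmanOperator μ g v) := by
  rw [crossedProductUnitary, mul_apply_eq_comp, l2Reindex_single, l2Ampl_single]
  simp

theorem crossedProductUnitary_elemVec_univ (g k : G) :
    crossedProductUnitary μ g (elemVec μ k MeasurableSet.univ) =
      elemVec μ (g * k) MeasurableSet.univ := by
  rw [elemVec, crossedProductUnitary_single, koopmanOperator_indL2_univ]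
  rfl

theorem crossedProductUnitary_vacuum (g : G) :
    crossedProductUnitary μ g (vacuum G μ) = elemVec μ g MeasurableSet.univ := by
  rw [vacuum, crossedProductUnitary_elemVec_univ, mul_one]

theorem rightTranslation_elemVec (g k : G) {B : Set X} (hB : MeasurableSet B) :
    rightTranslation μ g (elemVec μ k hB) = elemVec μ (k * g⁻¹) hB :=
  l2Reindex_single _ _ _

end Operators

/-! ### The trace and subalgebras determined by their vacuum orbit -/

section Trace

set_option linter.unusedSectionVars false

variable {G : Type*} [Group G] [DecidableEq G] {X : Type*} [MeasurableSpace X] [MulAction G X]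
  [MeasurableConstSMul G X] (μ : Measure X) [SMulInvariantMeasure G X μ] [IsFiniteMeasure μ]

/-- Every vector `δ_k ⊗ 1_B` is the image of the vacuum under an operator commuting with the
crossed product. -/
noncomputable def rightOp (k : G) {B : Set X} (hB : MeasurableSet B) :
    CrossedProductSpace G μ →L[ℂ] CrossedProductSpace G μ :=
  rightTranslation μ k⁻¹ * rightInd G μ hB

theorem rightOp_vacuum (k : G) {B : Set X} (hB : MeasurableSet B) :
    rightOp μ k hB (vacuum G μ) = elemVec μ k hB := by
  rw [rightOp, mul_apply_eq_comp, rightInd_vacuum, rightTranslation_elemVec, inv_inv, one_mul]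

/-- `rightOp` is right multiplication by 1_B u_k, so its adjoint sends Ω to (1_B u_k)⋆Ω, and u_k⋆
1_B = 1_{k⁻¹B} u_{k⁻¹}. -/
theorem star_rightOp_vacuum (k : G) {B : Set X} (hB : MeasurableSet B) :
    star (rightOp μ k hB) (vacuum G μ) = elemVec μ k⁻¹ (measurableSet_translate k⁻¹ hB) := by
  have h : star (rightTranslation μ k⁻¹) = rightTranslation μ k := by
    rw [star_rightTranslation, inv_inv]
  rw [rightOp, star_mul, star_rightInd, h, mul_apply_eq_comp, vacuum, rightTranslation_elemVec,
    one_mul, rightInd_elemVec_univ]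

variable {μ}

theorem rightOp_apply_comm {x : CrossedProductSpace G μ →L[ℂ] CrossedProductSpace G μ}
    (hx : x ∈ crossedProduct μ (⊤ : Subgroup G)) (k : G) {B : Set X} (hB : MeasurableSet B)
    (ξ : CrossedProductSpace G μ) : rightOp μ k hB (x ξ) = x (rightOp μ k hB ξ) := by
  have h : rightOp μ k hB * x = x * rightOp μ k hB := by
    rw [rightOp, mul_assoc, rightInd_commute μ hx, ← mul_assoc, rightTranslation_commute μ hx,
      mul_assoc]
  exact DFunLike.congr_fun h ξ

/-- The vacuum state is tracial on the crossed product. -/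
theorem norm_star_apply_vacuum {x : CrossedProductSpace G μ →L[ℂ] CrossedProductSpace G μ}
    (hx : x ∈ crossedProduct μ (⊤ : Subgroup G)) :
    ‖star x (vacuum G μ)‖ = ‖x (vacuum G μ)‖ := by
  -- In Fourier coefficients, (x⋆)_k is the complex conjugate of σ_k(x_{k⁻¹}). This is tested
  -- against 1_B by moving the right operators, which commute with x, across the inner product.
  have key : ∀ k : G, ‖star x (vacuum G μ) k‖ = ‖x (vacuum G μ) k⁻¹‖ := by
    intro k
    rw [← norm_koopmanOperator_apply μ k (x (vacuum G μ) k⁻¹)]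
    refine norm_eq_of_inner_indL2 fun B hB => ?_
    have h1 := inner_koopmanOperator_left μ k⁻¹ (indL2 μ hB) (x (vacuum G μ) k⁻¹)
    rw [inv_inv] at h1
    rw [← inner_elemVec_right, ← h1, koopmanOperator_indL2, ← inner_elemVec_left,
      ← star_rightOp_vacuum, ContinuousLinearMap.star_eq_adjoint,
      ContinuousLinearMap.adjoint_inner_left, ContinuousLinearMap.star_eq_adjoint,
      ContinuousLinearMap.adjoint_inner_left, rightOp_apply_comm hx, rightOp_vacuum]
  refine (sq_eq_sq₀ (norm_nonneg _) (norm_nonneg _)).1 ?_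
  rw [norm_sq_eq_tsum_l2, norm_sq_eq_tsum_l2]
  simp only [key]
  exact (Equiv.inv G).tsum_eq fun k => ‖x (vacuum G μ) k‖ ^ 2

/-- The closure of the orbit of the vacuum under a von Neumann algebra. -/
noncomputable def vacuumSpace (N : VonNeumannAlgebra (CrossedProductSpace G μ)) :
    Submodule ℂ (CrossedProductSpace G μ) :=
  (N.toSubalgebra.toSubmodule.map
    (ContinuousLinearMap.apply ℂ (CrossedProductSpace G μ)
      (vacuum G μ)).toLinearMap).topologicalClosure

instance (N : VonNeumannAlgebra (CrossedProductSpace G μ)) : CompleteSpace (vacuumSpace N) :=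
  inferInstanceAs (CompleteSpace (Submodule.topologicalClosure _))

theorem mem_vacuumSpace_iff {N : VonNeumannAlgebra (CrossedProductSpace G μ)}
    {ξ : CrossedProductSpace G μ} :
    ξ ∈ vacuumSpace N ↔
      ξ ∈ closure {η | ∃ x ∈ N, x (vacuum G μ) = η} := Iff.rfl

theorem apply_vacuum_mem_vacuumSpace {N : VonNeumannAlgebra (CrossedProductSpace G μ)}
    {x : CrossedProductSpace G μ →L[ℂ] CrossedProductSpace G μ} (hx : x ∈ N) :
    x (vacuum G μ) ∈ vacuumSpace N :=
  mem_vacuumSpace_iff.2 (subset_closure ⟨x, hx, rfl⟩)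

theorem map_mem_vacuumSpace {N : VonNeumannAlgebra (CrossedProductSpace G μ)}
    {T : CrossedProductSpace G μ →L[ℂ] CrossedProductSpace G μ}
    (hT : ∀ x ∈ N, ∃ y ∈ N, T (x (vacuum G μ)) = y (vacuum G μ)) {ξ : CrossedProductSpace G μ}
    (hξ : ξ ∈ vacuumSpace N) : T ξ ∈ vacuumSpace N := by
  rw [mem_vacuumSpace_iff] at hξ ⊢
  refine map_mem_closure T.continuous hξ ?_
  rintro _ ⟨x, hx, rfl⟩
  obtain ⟨y, hy, h⟩ := hT x hx
  exact ⟨y, hy, h.symm⟩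

/-- An element of the crossed product whose vacuum vector lies in the closure of the vacuum orbit
of a von Neumann subalgebra belongs to that subalgebra. -/
theorem mem_of_apply_vacuum_mem_vacuumSpace {N : VonNeumannAlgebra (CrossedProductSpace G μ)}
    (hN : N ≤ crossedProduct μ (⊤ : Subgroup G))
    {x : CrossedProductSpace G μ →L[ℂ] CrossedProductSpace G μ}
    (hx : x ∈ crossedProduct μ (⊤ : Subgroup G)) (hxN : x (vacuum G μ) ∈ vacuumSpace N) :
    x ∈ N := by
  obtain ⟨s, hs, hlim⟩ := mem_closure_iff_seq_limit.1 (mem_vacuumSpace_iff.1 hxN)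
  choose z hz hzs using hs
  have hzM n := hN (hz n)
  have hlim1 : Tendsto (fun n => z n (vacuum G μ)) atTop (𝓝 (x (vacuum G μ))) := by
    simpa only [hzs] using hlim
  -- The trace property turns convergence on Ω into convergence of the adjoints on Ω. No bound on ‖z
  -- n‖ is available, so both limits are needed below.
  have hlim2 : Tendsto (fun n => star (z n) (vacuum G μ)) atTop (𝓝 (star x (vacuum G μ))) := by
    rw [tendsto_iff_norm_sub_tendsto_zero] at hlim1 ⊢
    refine hlim1.congr fun n => ?_
    have h := norm_star_apply_vacuum (sub_mem (hzM n) hx)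
    simpa only [star_sub, sub_apply] using h.symm
  -- Right operators transport convergence at Ω to every vector δ_k ⊗ 1_B.
  have hright : ∀ {w : ℕ → CrossedProductSpace G μ →L[ℂ] CrossedProductSpace G μ}
      {y : CrossedProductSpace G μ →L[ℂ] CrossedProductSpace G μ},
      (∀ n, w n ∈ crossedProduct μ (⊤ : Subgroup G)) → y ∈ crossedProduct μ (⊤ : Subgroup G) →
      Tendsto (fun n => w n (vacuum G μ)) atTop (𝓝 (y (vacuum G μ))) →
      ∀ (k : G) (B : Set X) (hB : MeasurableSet B),
      Tendsto (fun n => w n (elemVec μ k hB)) atTop (𝓝 (y (elemVec μ k hB))) := by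
    intro w y hw hy hwy k B hB
    have h := ((rightOp μ k hB).continuous.tendsto _).comp hwy
    rw [rightOp_apply_comm hy, rightOp_vacuum] at h
    refine h.congr fun n => ?_
    rw [Function.comp_apply, rightOp_apply_comm (hw n), rightOp_vacuum]
  rw [← N.commutant_commutant, VonNeumannAlgebra.mem_commutant_iff]
  intro y hy
  rw [VonNeumannAlgebra.mem_commutant_iff] at hy
  -- For y in the commutant, pass to the limit in ⟨ζ, y z_n η⟩ = ⟨z_n⋆ ζ, y η⟩.
  have hinner : ∀ (k : G) (B : Set X) (hB : MeasurableSet B) (l : G) (C : Set X)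
      (hC : MeasurableSet C),
      ⟪elemVec μ l hC, y (x (elemVec μ k hB))⟫_ℂ = ⟪elemVec μ l hC, x (y (elemVec μ k hB))⟫_ℂ := by
    intro k B hB l C hC
    have t1 : Tendsto (fun n => ⟪elemVec μ l hC, y (z n (elemVec μ k hB))⟫_ℂ) atTop
        (𝓝 ⟪elemVec μ l hC, y (x (elemVec μ k hB))⟫_ℂ) :=
      tendsto_const_nhds.inner ((y.continuous.tendsto _).comp (hright hzM hx hlim1 k B hB))
    have t2 : Tendsto (fun n => ⟪star (z n) (elemVec μ l hC), y (elemVec μ k hB)⟫_ℂ) atTop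
        (𝓝 ⟪star x (elemVec μ l hC), y (elemVec μ k hB)⟫_ℂ) :=
      (hright (fun n => star_mem (hzM n)) (star_mem hx) hlim2 l C hC).inner tendsto_const_nhds
    rw [ContinuousLinearMap.star_eq_adjoint, ContinuousLinearMap.adjoint_inner_left] at t2
    refine tendsto_nhds_unique t1 (t2.congr fun n => ?_)
    rw [ContinuousLinearMap.star_eq_adjoint, ContinuousLinearMap.adjoint_inner_left]
    exact congrArg _ (DFunLike.congr_fun (hy (z n) (hz n)) (elemVec μ k hB))
  have hzero : ∀ (k : G) (B : Set X) (hB : MeasurableSet B),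
      (y * x - x * y) (elemVec μ k hB) = 0 := by
    intro k B hB
    refine eq_zero_of_inner_elemVec μ fun l C hC => ?_
    rw [sub_apply, mul_apply_eq_comp, mul_apply_eq_comp, inner_sub_right,
      hinner k B hB l C hC, sub_self]
  -- The commutator kills a total set of vectors, so the range of its adjoint is orthogonal to that
  -- set.
  have hstar : star (y * x - x * y) = 0 := by
    ext1 ξ
    refine eq_zero_of_inner_elemVec μ fun k B hB => ?_
    rw [ContinuousLinearMap.star_eq_adjoint, ContinuousLinearMap.adjoint_inner_right, hzero,
      inner_zero_left]
  exact sub_eq_zero.1 (star_eq_zero.1 hstar)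

end Trace

/-! ### The projection onto the vacuum space of an intermediate algebra -/

section Intermediate

set_option linter.unusedSectionVars false

variable {G : Type*} [Group G] [DecidableEq G] {X : Type*} [MeasurableSpace X] [MulAction G X]
  [MeasurableConstSMul G X] {μ : Measure X} [SMulInvariantMeasure G X μ] [IsFiniteMeasure μ]
  {N : VonNeumannAlgebra (CrossedProductSpace G μ)}

theorem starProjection_leftInd (hL : ∀ f : Lp ℂ ∞ μ, crossedProductFun G f ∈ N) {B : Set X}
    (hB : MeasurableSet B) (ξ : CrossedProductSpace G μ) :
    (vacuumSpace N).starProjection (leftInd G μ hB ξ) =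
      leftInd G μ hB ((vacuumSpace N).starProjection ξ) := by
  have h : ∀ v ∈ vacuumSpace N, leftInd G μ hB v ∈ vacuumSpace N := fun v =>
    map_mem_vacuumSpace fun x hx => ⟨leftInd G μ hB * x, mul_mem (hL _) hx, rfl⟩
  exact starProjection_apply_comm _ h (by rwa [star_leftInd]) ξ

/-- For x ∈ N, R_B xΩ = x R_B Ω = x 1_B Ω, and x 1_B ∈ N; thus the vacuum space is invariant under
the self-adjoint R_B. -/
theorem starProjection_rightInd (hN : N ≤ crossedProduct μ (⊤ : Subgroup G))
    (hL : ∀ f : Lp ℂ ∞ μ, crossedProductFun G f ∈ N) {B : Set X}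
    (hB : MeasurableSet B) (ξ : CrossedProductSpace G μ) :
    (vacuumSpace N).starProjection (rightInd G μ hB ξ) =
      rightInd G μ hB ((vacuumSpace N).starProjection ξ) := by
  have h : ∀ v ∈ vacuumSpace N, rightInd G μ hB v ∈ vacuumSpace N := fun v =>
    map_mem_vacuumSpace fun x hx => ⟨x * leftInd G μ hB, mul_mem hx (hL _), by
      have h1 : leftInd G μ hB (vacuum G μ) = rightInd G μ hB (vacuum G μ) := by
        rw [rightInd_vacuum, vacuum, leftInd_elemVec_univ]
      rw [mul_apply_eq_comp, h1]
      exact DFunLike.congr_fun (rightInd_commute μ (hN hx) hB) (vacuum G μ)⟩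
  exact starProjection_apply_comm _ h (by rwa [star_rightInd]) ξ

theorem crossedProductUnitary_inv_mem {g : G} (hg : crossedProductUnitary μ g ∈ N) :
    crossedProductUnitary μ g⁻¹ ∈ N := by
  rw [← star_crossedProductUnitary]
  exact star_mem hg

theorem starProjection_crossedProductUnitary {g : G} (hg : crossedProductUnitary μ g ∈ N)
    (ξ : CrossedProductSpace G μ) :
    (vacuumSpace N).starProjection (crossedProductUnitary μ g ξ) =
      crossedProductUnitary μ g ((vacuumSpace N).starProjection ξ) := by
  have h : ∀ k : G, crossedProductUnitary μ k ∈ N → ∀ v ∈ vacuumSpace N,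
      crossedProductUnitary μ k v ∈ vacuumSpace N := fun k hk v =>
    map_mem_vacuumSpace fun x hx => ⟨crossedProductUnitary μ k * x, mul_mem hk hx, rfl⟩
  refine starProjection_apply_comm _ (h g hg) ?_ ξ
  rw [star_crossedProductUnitary]
  exact h _ (crossedProductUnitary_inv_mem hg)

theorem starProjection_rightTranslation (hN : N ≤ crossedProduct μ (⊤ : Subgroup G)) {g : G}
    (hg : crossedProductUnitary μ g ∈ N) (ξ : CrossedProductSpace G μ) :
    (vacuumSpace N).starProjection (rightTranslation μ g ξ) =
      rightTranslation μ g ((vacuumSpace N).starProjection ξ) := by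
  have h : ∀ k : G, crossedProductUnitary μ k⁻¹ ∈ N → ∀ v ∈ vacuumSpace N,
      rightTranslation μ k v ∈ vacuumSpace N := fun k hk v =>
    map_mem_vacuumSpace fun x hx => ⟨x * crossedProductUnitary μ k⁻¹, mul_mem hx hk, by
      have h1 : rightTranslation μ k (vacuum G μ) = elemVec μ k⁻¹ MeasurableSet.univ := by
        rw [vacuum, rightTranslation_elemVec, one_mul]
      rw [mul_apply_eq_comp, crossedProductUnitary_vacuum, ← h1]
      exact DFunLike.congr_fun (rightTranslation_commute μ (hN hx) k) (vacuum G μ)⟩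
  refine starProjection_apply_comm _ (h g (crossedProductUnitary_inv_mem hg)) ?_ ξ
  rw [star_rightTranslation]
  exact h _ (by rwa [inv_inv])

/-- By freeness, the projection of `δ_g ⊗ 1` is supported on the coordinate `g`. -/
theorem starProjection_elemVec_apply_of_ne [MeasurableSpace.CountablySeparated X]
    (hfree : IsFreeAction G μ) (hN : N ≤ crossedProduct μ (⊤ : Subgroup G))
    (hL : ∀ f : Lp ℂ ∞ μ, crossedProductFun G f ∈ N) {g k : G} (hk : k ≠ g) :
    (vacuumSpace N).starProjection (elemVec μ g MeasurableSet.univ) k = 0 := by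
  set ξ := (vacuumSpace N).starProjection (elemVec μ g MeasurableSet.univ) with hξ
  -- This is u_g 1_B = 1_{gB} u_g, carried through the projection.
  have hcomm : ∀ (B : Set X) (hB : MeasurableSet B),
      rightInd G μ hB ξ = leftInd G μ (measurableSet_translate g hB) ξ := by
    intro B hB
    rw [hξ, ← starProjection_rightInd hN hL, ← starProjection_leftInd hL, rightInd_elemVec_univ,
      leftInd_elemVec_univ]
  obtain ⟨S, hSc, hSm, hS⟩ :=
    exists_countable_separating X MeasurableSet (Set.univ : Set X)
  -- Where ξ k is nonzero, no set of the separating family distinguishes k⁻¹x from g⁻¹x. These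
  -- points therefore coincide and gk⁻¹ fixes x, which freeness excludes almost everywhere.
  have hae : ∀ᵐ x ∂μ, ∀ B ∈ S, ξ k x ≠ 0 → (k⁻¹ • x ∈ B ↔ g⁻¹ • x ∈ B) := by
    rw [ae_ball_iff hSc]
    intro B hBS
    have hB := hSm B hBS
    have h1 : mulOperator (indLinf μ (measurableSet_translate k hB)) (ξ k) =
        mulOperator (indLinf μ (measurableSet_translate g hB)) (ξ k) :=
      congrArg (fun η : CrossedProductSpace G μ => η k) (hcomm B hB)
    have h2 := coeFn_mulOperator_indLinf (measurableSet_translate g hB) (ξ k)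
    rw [← h1] at h2
    filter_upwards [coeFn_mulOperator_indLinf (measurableSet_translate k hB) (ξ k), h2]
      with x hx1 hx2 hx0
    rw [hx1] at hx2
    refine ⟨fun h3 => ?_, fun h4 => ?_⟩
    · by_contra h4
      rw [Set.indicator_of_mem (by exact h3), Set.indicator_of_notMem (by exact h4)] at hx2
      exact hx0 hx2
    · by_contra h3
      rw [Set.indicator_of_notMem (by exact h3), Set.indicator_of_mem (by exact h4)] at hx2
      exact hx0 hx2.symm
  rw [Lp.eq_zero_iff_ae_eq_zero]
  have hgk : g * k⁻¹ ≠ 1 := fun h => hk (mul_inv_eq_one.1 h).symm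
  filter_upwards [hae, hfree _ hgk] with x hx hx'
  by_contra h0
  refine hx' ?_
  rw [mul_smul, hS _ (Set.mem_univ _) _ (Set.mem_univ _) fun B hB => hx B hB h0, smul_inv_smul]

theorem eq_single_of_apply_eq_zero {g : G} {ξ : CrossedProductSpace G μ}
    (h : ∀ k, k ≠ g → ξ k = 0) : ξ = lp.single 2 g (ξ g) := by
  refine lp.ext (funext fun k => ?_)
  by_cases hk : k = g
  · subst hk; simp
  · rw [h k hk, lp.single_apply_ne _ _ _ hk]

/-- The projection of `δ_g ⊗ 1` is of the form `δ_g ⊗ f` with `f` an indicator function. -/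
theorem starProjection_elemVec_apply_self_ae [MeasurableSpace.CountablySeparated X]
    (hfree : IsFreeAction G μ) (hN : N ≤ crossedProduct μ (⊤ : Subgroup G))
    (hL : ∀ f : Lp ℂ ∞ μ, crossedProductFun G f ∈ N) (g : G) :
    ∀ᵐ x ∂μ, (vacuumSpace N).starProjection (elemVec μ g MeasurableSet.univ) g x = 0 ∨
      (vacuumSpace N).starProjection (elemVec μ g MeasurableSet.univ) g x = 1 := by
  set ξ := (vacuumSpace N).starProjection (elemVec μ g MeasurableSet.univ) with hξ
  have hsingle : ξ = lp.single 2 g (ξ g) :=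
    eq_single_of_apply_eq_zero fun k hk => starProjection_elemVec_apply_of_ne hfree hN hL hk
  have hint : Integrable (fun x => ⟪ξ g x, ξ g x⟫_ℂ - ξ g x) μ :=
    (L2.integrable_inner (𝕜 := ℂ) (ξ g) (ξ g)).sub (integrable_coeFn_L2 (ξ g))
  -- With f = ξ g, idempotence gives ∫_B |f|² = ⟨1_B ξ, ξ⟩ = ⟨δ_g ⊗ 1_B, ξ⟩ = ∫_B f for every B,
  -- hence |f|² = f.
  have h0 : (fun x => ⟪ξ g x, ξ g x⟫_ℂ - ξ g x) =ᵐ[μ] 0 := by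
    refine hint.ae_eq_zero_of_forall_setIntegral_eq_zero fun B hB _ => ?_
    rw [integral_sub (L2.integrable_inner (𝕜 := ℂ) (ξ g) (ξ g)).integrableOn
      (integrable_coeFn_L2 (ξ g)).integrableOn, sub_eq_zero, ← inner_indL2_left hB,
      ← inner_elemVec_left, ← leftInd_elemVec_univ]
    have h1 : ⟪leftInd G μ hB (elemVec μ g MeasurableSet.univ), ξ⟫_ℂ =
        ⟪leftInd G μ hB ξ, ξ⟫_ℂ := by
      conv_rhs => rw [hξ, ← starProjection_leftInd hL, Submodule.inner_starProjection_left_eq_right,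
        Submodule.starProjection_eq_self_iff.2 (Submodule.starProjection_apply_mem _ _), ← hξ]
    have h2 : ⟪leftInd G μ hB ξ, ξ⟫_ℂ = ⟪mulOperator (indLinf μ hB) (ξ g), ξ g⟫_ℂ := by
      conv_lhs => rw [hsingle, lp.inner_single_right, leftInd_apply, lp.single_apply_self]
    rw [h1, h2, L2.inner_def, ← integral_indicator hB]
    refine integral_congr_ae ?_
    filter_upwards [coeFn_mulOperator_indLinf hB (ξ g)] with x hx
    rw [hx]
    by_cases hxB : x ∈ B <;> simp [hxB]
  filter_upwards [h0] with x hx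
  have hx' : ((‖ξ g x‖ : ℂ)) ^ 2 = ξ g x := by
    rw [Pi.zero_apply, sub_eq_zero, inner_self_eq_norm_sq_to_K] at hx
    exact hx
  have hr : ‖ξ g x‖ ^ 2 = ‖ξ g x‖ := by
    have := congrArg norm hx'
    simpa using this
  have hr' : ‖ξ g x‖ * (‖ξ g x‖ - 1) = 0 := by linear_combination hr
  rcases mul_eq_zero.1 hr' with h | h
  · exact Or.inl (norm_eq_zero.1 h)
  · right
    rw [← hx', sub_eq_zero.1 h]
    simp

/-- Since hg = gk, left multiplication by u_h and right multiplication by u_k agree on δ_g ⊗ 1,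
hence on its projection; the claim is the equality of their coordinates at hg. -/
theorem koopmanOperator_starProjection_elemVec (hN : N ≤ crossedProduct μ (⊤ : Subgroup G))
    {g h k : G} (hhg : h * g = g * k) (hh : crossedProductUnitary μ h ∈ N)
    (hk : crossedProductUnitary μ k ∈ N) :
    koopmanOperator μ h ((vacuumSpace N).starProjection (elemVec μ g MeasurableSet.univ) g) =
      (vacuumSpace N).starProjection (elemVec μ g MeasurableSet.univ) g := by
  set ξ := (vacuumSpace N).starProjection (elemVec μ g MeasurableSet.univ) with hξ
  have h1 : crossedProductUnitary μ h ξ = rightTranslation μ k⁻¹ ξ := by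
    rw [hξ, ← starProjection_crossedProductUnitary hh,
      ← starProjection_rightTranslation hN (crossedProductUnitary_inv_mem hk),
      crossedProductUnitary_elemVec_univ, rightTranslation_elemVec, inv_inv, hhg]
  have h2 := congrArg (fun η : CrossedProductSpace G μ => η (h * g)) h1
  simp only [crossedProductUnitary_apply, rightTranslation_apply, inv_mul_cancel_left] at h2
  rwa [hhg, mul_inv_cancel_right] at h2

theorem vacuumSpace_dichotomy [IsProbabilityMeasure μ] [MeasurableSpace.CountablySeparated X]
    (hfree : IsFreeAction G μ) (hmix : IsMixingAction G μ)
    (hN : N ≤ crossedProduct μ (⊤ : Subgroup G))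
    (hL : ∀ f : Lp ℂ ∞ μ, crossedProductFun G f ∈ N) {H : Subgroup G} (hH : IsRoughlyNormal H)
    (hHN : ∀ h ∈ H, crossedProductUnitary μ h ∈ N) (g : G) :
    (vacuumSpace N).starProjection (elemVec μ g MeasurableSet.univ) = 0 ∨
      (vacuumSpace N).starProjection (elemVec μ g MeasurableSet.univ) =
        elemVec μ g MeasurableSet.univ := by
  have hsingle := eq_single_of_apply_eq_zero
    fun k hk => starProjection_elemVec_apply_of_ne hfree hN hL (g := g) (k := k) hk
  have h01 := starProjection_elemVec_apply_self_ae hfree hN hL g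
  have hinv : ∀ h ∈ H, g⁻¹ * h * g ∈ H → koopmanOperator μ h
      ((vacuumSpace N).starProjection (elemVec μ g MeasurableSet.univ) g) =
      (vacuumSpace N).starProjection (elemVec μ g MeasurableSet.univ) g := fun h hh hk =>
    koopmanOperator_starProjection_elemVec hN (by group) (hHN h hh) (hHN _ hk)
  rw [hsingle]
  generalize (vacuumSpace N).starProjection (elemVec μ g MeasurableSet.univ) g = f at *
  set D : Set X := {x | f x = 1} with hD
  have hDm : MeasurableSet D := (Lp.stronglyMeasurable f).measurable (measurableSet_singleton 1)
  have hfreq : ∃ᶠ h : G in cofinite, μ ((fun x : X => h • x) ⁻¹' D ∩ D) ∈ ({μ D} : Set ℝ≥0∞) := by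
    rw [frequently_cofinite_iff_infinite]
    -- Rough normality at g⁻¹ yields infinitely many h ∈ H ∩ gHg⁻¹, that is, with g⁻¹hg ∈ H.
    refine (hH.2 g⁻¹).mono ?_
    rintro h ⟨hh, hh'⟩
    obtain ⟨k, hk, hkh⟩ := hh'
    have hkH : g⁻¹ * h⁻¹ * g ∈ H := by
      have : g⁻¹ * h⁻¹ * g = k⁻¹ := by
        rw [← hkh]
        simp [mul_assoc]
      rw [this]
      exact inv_mem hk
    refine measure_congr ?_
    -- The inverse is used because σ_{h⁻¹} f is x ↦ f(hx), matching the preimage in the mixing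
    -- condition.
    have hkoop := coeFn_koopmanOperator μ h⁻¹ f
    rw [hinv h⁻¹ (inv_mem hh) hkH, inv_inv] at hkoop
    rw [eventuallyEq_set]
    filter_upwards [hkoop] with x hx
    simp [hD, ← hx]
  have hsq : μ D * μ D = μ D :=
    isClosed_singleton.mem_of_frequently_of_tendsto hfreq (hmix D D hDm hDm)
  by_cases hD0 : μ D = 0
  · left
    have hf : f = 0 := by
      rw [Lp.eq_zero_iff_ae_eq_zero]
      filter_upwards [h01, measure_eq_zero_iff_ae_notMem.1 hD0] with x hx hx'
      exact hx.resolve_right hx'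
    rw [hf, lp.single_zero]
  · right
    have hD1 : μ D = 1 := by
      rw [← ENNReal.mul_right_inj hD0 (measure_ne_top μ D), hsq, mul_one]
    have hf : f = indL2 μ MeasurableSet.univ := by
      ext1
      filter_upwards [(mem_ae_iff_prob_eq_one hDm).2 hD1,
        coeFn_indL2 (μ := μ) MeasurableSet.univ] with x hx hx'
      rw [hx', show f x = 1 from hx]
      simp
    rw [hf, elemVec]

end Intermediate

/-! ### ### Intermediate algebras come from subgroups -/

theorem mainTheorem9 {G : Type*} [Group G] [Countable G]
    {X : Type*} [MeasurableSpace X] [MeasurableSpace.CountablySeparated X]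
    (μ : Measure X) [IsProbabilityMeasure μ]
    [MulAction G X] [MeasurableConstSMul G X] [SMulInvariantMeasure G X μ]
    (hfree : IsFreeAction G μ) (hmix : IsMixingAction G μ)
    (H : Subgroup G) (hH : IsRoughlyNormal H)
    (P : VonNeumannAlgebra (CrossedProductSpace G μ))
    (hHP : crossedProduct μ H ≤ P) (hPG : P ≤ crossedProduct μ (⊤ : Subgroup G)) :
    ∃ K : Subgroup G, H ≤ K ∧ P = crossedProduct μ K := by
  classical
  have hL : ∀ f : Lp ℂ ∞ μ, crossedProductFun G f ∈ P :=
    fun f => hHP (crossedProductFun_mem μ H f)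
  have hHu : ∀ h ∈ H, crossedProductUnitary μ h ∈ P :=
    fun h hh => hHP (crossedProductUnitary_mem μ hh)
  let K : Subgroup G :=
    { carrier := {g | crossedProductUnitary μ g ∈ P}
      mul_mem' := fun {g h} hg hh => by
        rw [Set.mem_ofPred_eq, crossedProductUnitary_mul]
        exact mul_mem hg hh
      one_mem' := by
        rw [Set.mem_ofPred_eq, crossedProductUnitary_one]
        exact one_mem P
      inv_mem' := fun {g} hg => crossedProductUnitary_inv_mem hg }
  have hKP : crossedProduct μ K ≤ P := crossedProduct_le μ hL fun g hg => hg
  refine ⟨K, hHu, le_antisymm (fun x hx => ?_) hKP⟩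
  refine mem_of_apply_vacuum_mem_vacuumSpace (hKP.trans hPG) (hPG hx) ?_
  -- Membership in the closed vacuum space is tested against its orthogonal complement. Each term of
  -- the inner product vanishes: η is zero at coordinates in K, and xΩ is zero at the others.
  rw [← Submodule.orthogonal_orthogonal (vacuumSpace (crossedProduct μ K)),
    Submodule.mem_orthogonal]
  intro η hη
  rw [Submodule.mem_orthogonal] at hη
  rw [lp.inner_eq_tsum]
  refine (tsum_congr fun k => ?_).trans tsum_zero
  by_cases hk : k ∈ K
  · have hηk : η k = 0 := eq_zero_of_inner_indL2 fun B hB => by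
      rw [← inner_elemVec_left, ← leftInd_elemVec_univ, ← crossedProductUnitary_vacuum]
      exact hη _ (apply_vacuum_mem_vacuumSpace (x := leftInd G μ hB * crossedProductUnitary μ k)
        (mul_mem (crossedProductFun_mem μ K _) (crossedProductUnitary_mem μ hk)))
    rw [hηk, inner_zero_left]
  -- If the projection fixed δ_k ⊗ 1 = u_kΩ, then u_k would lie in P, contradicting k ∉ K.
  · have hzero : (vacuumSpace P).starProjection (elemVec μ k MeasurableSet.univ) = 0 := by
      refine (vacuumSpace_dichotomy hfree hmix hPG hL hH hHu k).resolve_right fun h1 => hk ?_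
      refine mem_of_apply_vacuum_mem_vacuumSpace hPG
        (crossedProductUnitary_mem μ (Subgroup.mem_top k)) ?_
      rw [crossedProductUnitary_vacuum, ← h1]
      exact Submodule.starProjection_apply_mem _ _
    have hxk : x (vacuum G μ) k = 0 := eq_zero_of_inner_indL2 fun B hB => by
      rw [← inner_elemVec_left,
        ← Submodule.starProjection_eq_self_iff.2 (apply_vacuum_mem_vacuumSpace hx),
        ← Submodule.inner_starProjection_left_eq_right, ← leftInd_elemVec_univ,
        starProjection_leftInd hL, hzero, map_zero, inner_zero_left]
    rw [hxk, inner_zero_right]
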